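/- A finite word over a finite alphabet $\Sigma$ is an element of $\Sigma^\star$. The convolution of words $x_1,\dots,x_k\in\Sigma^\star$ is the word over $(\Sigma\cup\{\Diamond\})^k$ obtained by padding each $x_j$ at its end with the new symbol $\Diamond$ up to the maximal length of the $x_j$ and reading the padded words in parallel. A relation $R\subseteq(\Sigma^\star)^k$ is regular if the set of convolutions of its tuples is recognized by a finite automaton. A structure is called word automatic if it is isomorphic to a structure whose domain is a regular set of words over some finite alphabet and all of whose basic relations and graphs of basic operations (including constants) are regular. A Boolean algebra is regarded as a structure $(D;\vee,\wedge,\neg,0,1)$. Let $\mathcal B_\omega$ be the Boolean algebra of all finite and cofinite subsets of $\omega$, with the set operations, and let $\mathcal B_\omega^n$ be its $n$-fold Cartesian power. Theorem (Khoussainov, Nies, Rubin, Stephan; 2004). A Boolean algebra is word automatic if and only if it is finite or isomorphic to $\mathcal B_\omega^n$ for some $n\geq 1$. (In particular, an infinite Boolean algebra is word automatic if and only if it is isomorphic to $\mathcal B_\omega^n$ for some $n\ge 1$.) -/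

import Mathlib

/-! ### Regular relations on finite words -/

/-- The convolution of the words `x 0, …, x (k - 1)` over the alphabet `A`: a word whose length is
the maximal length of the `x j`, and whose `i`-th letter is the tuple of the `i`-th letters of the
`x j`, where `none` is the padding symbol `◇` used beyond the end of a word. -/
def convolution {A : Type*} {k : ℕ} (x : Fin k → List A) : List (Fin k → Option A) :=
  List.ofFn (n := Finset.univ.sup fun j => (x j).length) fun i j => (x j)[(i : ℕ)]?

/-- The convolution of a `k`-ary relation on words, as a language over `(A ∪ {◇})^k`. -/
def convolutionLanguage {A : Type*} {k : ℕ} (R : Set (Fin k → List A)) :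
    _root_.Language (Fin k → Option A) :=
  convolution '' R

/-- A relation on words is regular if its convolution is a regular language. -/
def IsRegularRelation {A : Type*} {k : ℕ} (R : Set (Fin k → List A)) : Prop :=
  (convolutionLanguage R).IsRegular

/-! ### Word automatic structures -/

/-- The graph of an operation on a set `D` of words, as a relation on words. -/
def wordGraph {A : Type*} {D : Set (List A)} {k : ℕ} (f : (Fin k → D) → D) :
    Set (Fin (k + 1) → List A) :=
  {x | ∃ a : Fin k → D, x = Fin.snoc (fun i => (a i : List A)) (f a : List A)}

/-- A relation on a set `D` of words, as a relation on words. -/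
def wordRelation {A : Type*} {D : Set (List A)} {k : ℕ} (r : (Fin k → D) → Prop) :
    Set (Fin k → List A) :=
  {x | ∃ a : Fin k → D, r a ∧ x = fun i => (a i : List A)}

/-- A structure whose domain is a set `D` of words over `A` is word automatic if its domain and its
basic operations (through their graphs) and relations are regular. -/
structure IsWordAutomatic (L : FirstOrder.Language) {A : Type} (D : Set (List A))
    [L.Structure D] : Prop where
  domain : _root_.Language.IsRegular (T := A) D
  operations : ∀ (k : ℕ) (f : L.Functions k),
    IsRegularRelation (wordGraph fun a : Fin k → D => FirstOrder.Language.Structure.funMap f a)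
  relations : ∀ (k : ℕ) (r : L.Relations k),
    IsRegularRelation (wordRelation fun a : Fin k → D => FirstOrder.Language.Structure.RelMap r a)

/-- A structure is word automata presentable if it is isomorphic to a word automatic structure over
some finite alphabet. -/
def IsWordAutomataPresentable (L : FirstOrder.Language) (M : Type*) [L.Structure M] : Prop :=
  ∃ (A : Type) (_ : Finite A) (D : Set (List A)) (_ : L.Structure D),
    IsWordAutomatic L D ∧ Nonempty (L.Equiv M D)

/-! ### Boolean algebras as structures `(D; ∨, ∧, ¬, 0, 1)` -/

/-- The operation symbols of Boolean algebras, indexed by their arities. -/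
inductive BooleanFunctions : ℕ → Type
  | bot : BooleanFunctions 0
  | top : BooleanFunctions 0
  | compl : BooleanFunctions 1
  | sup : BooleanFunctions 2
  | inf : BooleanFunctions 2

/-- The first-order language of Boolean algebras. -/
def booleanLanguage : FirstOrder.Language where
  Functions := BooleanFunctions
  Relations := fun _ => Empty

/-- A Boolean algebra as a first-order structure. -/
instance booleanStructure (B : Type*) [BooleanAlgebra B] : booleanLanguage.Structure B where
  funMap := fun {_} f => match f with
    | BooleanFunctions.bot => fun _ => ⊥
    | BooleanFunctions.top => fun _ => ⊤
    | BooleanFunctions.compl => fun a => (a 0)ᶜ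
    | BooleanFunctions.sup => fun a => a 0 ⊔ a 1
    | BooleanFunctions.inf => fun a => a 0 ⊓ a 1
  RelMap := fun {_} r => r.elim

/-- `B_ω`: the Boolean algebra of all finite and cofinite subsets of `ℕ`. -/
def finiteCofinite : BooleanSubalgebra (Set ℕ) where
  carrier := {s | s.Finite ∨ sᶜ.Finite}
  bot_mem' := Or.inl Set.finite_empty
  compl_mem' := by
    intro s hs
    simpa [or_comm] using hs
  supClosed' := by
    rintro s (hs | hs) t (ht | ht)
    · exact Or.inl (hs.union ht)
    · exact Or.inr (ht.subset (Set.compl_subset_compl.2 Set.subset_union_right))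
    · exact Or.inr (hs.subset (Set.compl_subset_compl.2 Set.subset_union_left))
    · exact Or.inr (hs.subset (Set.compl_subset_compl.2 Set.subset_union_left))
  infClosed' := by
    rintro s (hs | hs) t (ht | ht)
    · exact Or.inl (hs.subset Set.inter_subset_left)
    · exact Or.inl (hs.subset Set.inter_subset_left)
    · exact Or.inl (ht.subset Set.inter_subset_right)
    · right
      change (s ∩ t)ᶜ.Finite
      rw [Set.compl_inter]
      exact hs.union ht

/-! ### Convolutions and pumping -/

/-! Necessity is a counting argument on word length. By pumping, the operations lengthen words by at
most a constant `c`, and an element with infinitely many elements below it splits into two nonzero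
disjoint parts at the same cost (`exists_isTameLength`). Peeling therefore yields `2 ^ r` disjoint
nonzero pieces of length about `c * 2 ^ r`, while a balanced tree forms joins of pieces at only
logarithmic extra cost.

Given `2 ^ s` disjoint infinite elements, the pieces below them have `2 ^ (2 ^ s * 2 ^ r)` distinct
joins, all of length about `c * 2 ^ r`. Only exponentially many words are that short, which is
impossible for large `s` and `r` (`exists_bound`). Hence the top is a finite join of disjoint
indecomposable elements. Each of these has infinitely many atoms below it, and every element of the
algebra contains finitely or cofinitely many of them, which gives a power of `finiteCofinite`.

Conversely, an element of the `n`-th power is an eventually constant sequence in `Set (Fin n)`. A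
code starting with the tail value and followed by the shortest sufficient prefix makes the domain
and the pointwise operations locally checkable, hence regular. -/

theorem List.getElem?_take_append_drop_of_le {A : Type*} (w : List A) {i j : ℕ} (h : i ≤ j)
    (t : ℕ) :
    (w.take i ++ w.drop j)[t]? = if t < i then w[t]? else w[j + (t - i)]? := by
  simp only [List.getElem?_append, List.length_take, List.getElem?_take, List.getElem?_drop]
  by_cases ht : t < i
  · by_cases hw : t < w.length
    · simp [ht, hw]
    · rw [if_neg (by omega), if_pos ht, List.getElem?_eq_none (by omega),
        List.getElem?_eq_none (by omega)]
  · rw [if_neg (by omega), if_neg ht]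
    by_cases hw : i ≤ w.length
    · rw [min_eq_left hw]
    · rw [List.getElem?_eq_none (by omega), List.getElem?_eq_none (by omega)]

/-- The second clause fixes the length: without it, trailing letters made of padding only would go
unnoticed. -/
theorem eq_convolution_iff {A : Type*} {k : ℕ} (x : Fin k → List A)
    (w : List (Fin k → Option A)) :
    w = convolution x ↔ (∀ (t : ℕ) (l : Fin k), (w[t]?).bind (fun a => a l) = (x l)[t]?) ∧
      ∀ t : ℕ, w[t]? ≠ some fun _ => none := by
  have key : ∀ t, (convolution x)[t]? =
      if t < Finset.univ.sup (fun j => (x j).length) then some fun j => (x j)[t]? else none := by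
    intro t
    simp [convolution, List.getElem?_ofFn]
  have long : ∀ t, ¬ t < Finset.univ.sup (fun j => (x j).length) → ∀ l, (x l)[t]? = none := by
    intro t ht l
    have : (x l).length ≤ Finset.univ.sup fun j => (x j).length :=
      Finset.le_sup (f := fun j => (x j).length) (Finset.mem_univ l)
    exact List.getElem?_eq_none (by omega)
  constructor
  · rintro rfl
    refine ⟨fun t l => ?_, fun t => ?_⟩
    · rw [key]
      split_ifs with ht
      · rfl
      · rw [long t ht]; rfl
    · rw [key]
      split_ifs with ht
      · intro h
        obtain ⟨l, -, hl⟩ := Finset.lt_sup_iff.1 ht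
        have := congrFun (Option.some.inj h) l
        simp at this
        omega
      · simp
  · rintro ⟨h1, h2⟩
    refine List.ext_getElem? fun t => ?_
    rw [key]
    rcases hw : w[t]? with _ | a
    · rw [if_neg]
      intro ht
      obtain ⟨l, -, hl⟩ := Finset.lt_sup_iff.1 ht
      have := h1 t l
      rw [hw] at this
      simp at this
      omega
    · have ha : a = fun l => (x l)[t]? := by
        funext l
        have := h1 t l
        rw [hw] at this
        exact this
      rw [if_pos, ha]
      by_contra ht
      exact h2 t (by rw [hw, ha]; congr 1; funext l; exact long t ht l)

theorem convolution_getElem?_bind {A : Type*} {k : ℕ} (x : Fin k → List A) (t : ℕ) (l : Fin k) :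
    ((convolution x)[t]?).bind (fun a => a l) = (x l)[t]? :=
  ((eq_convolution_iff x _).1 rfl).1 t l

theorem convolution_getElem?_ne {A : Type*} {k : ℕ} (x : Fin k → List A) (t : ℕ) :
    (convolution x)[t]? ≠ some fun _ => none :=
  ((eq_convolution_iff x _).1 rfl).2 t

theorem convolution_injective {A : Type*} {k : ℕ} :
    Function.Injective (convolution : (Fin k → List A) → _) := by
  intro x y h
  funext l
  refine List.ext_getElem? fun t => ?_
  rw [← convolution_getElem?_bind x, h, convolution_getElem?_bind]

theorem convolution_mem_convolutionLanguage {A : Type*} {k : ℕ} {R : Set (Fin k → List A)}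
    {x : Fin k → List A} : convolution x ∈ convolutionLanguage R ↔ x ∈ R :=
  convolution_injective.mem_set_image

theorem convolution_take_append_drop {A : Type*} {k : ℕ} (x : Fin k → List A) {i j : ℕ}
    (h : i ≤ j) :
    (convolution x).take i ++ (convolution x).drop j =
      convolution fun l => (x l).take i ++ (x l).drop j := by
  rw [eq_convolution_iff]
  simp only [List.getElem?_take_append_drop_of_le _ h]
  refine ⟨fun t l => ?_, fun t => ?_⟩
  · split_ifs <;> exact convolution_getElem?_bind _ _ _
  · split_ifs <;> exact convolution_getElem?_ne _ _

/-- Pumping down one component of a tuple of words, the others being short. -/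
theorem IsRegularRelation.exists_pumping {A : Type*} {k : ℕ} {R : Set (Fin k → List A)}
    (hR : IsRegularRelation R) :
    ∃ c : ℕ, ∀ x ∈ R, ∀ (l : Fin k) (m : ℕ), (∀ i, i ≠ l → (x i).length ≤ m) →
      m + c < (x l).length →
      ∃ y, Function.update x l y ∈ R ∧ m ≤ y.length ∧ y.length < (x l).length := by
  obtain ⟨σ, hσ, M, hM⟩ := hR
  refine ⟨Fintype.card σ, fun x hx l m hm hl => ?_⟩
  have hacc : M.eval (convolution x) ∈ M.accept := by
    rw [← DFA.mem_accepts, hM]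
    exact convolution_mem_convolutionLanguage.2 hx
  -- Two prefixes of lengths between `m` and `m + card σ` reach the same state. Beyond position `m`
  -- only component `l` is still being read, so cutting out the segment between them changes that
  -- component alone.
  obtain ⟨a, b, hab, he⟩ := Fintype.exists_ne_map_eq_of_card_lt
    (fun t : Fin (Fintype.card σ + 1) => M.eval ((convolution x).take (m + t))) (by simp)
  wlog hlt : a < b generalizing a b
  · exact this b a hab.symm he.symm (lt_of_le_of_ne (not_lt.1 hlt) hab.symm)
  have hlt' : (a : ℕ) < b := hlt
  have hb := b.2
  refine ⟨(x l).take (m + a) ++ (x l).drop (m + b), ?_, ?_, ?_⟩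
  · have hcut : Function.update x l ((x l).take (m + a) ++ (x l).drop (m + b)) =
        fun i => (x i).take (m + a) ++ (x i).drop (m + b) := by
      funext i
      by_cases hi : i = l
      · subst hi; simp
      · have := hm i hi
        rw [Function.update_of_ne hi, List.take_of_length_le (by omega),
          List.drop_eq_nil_of_le (by omega), List.append_nil]
    rw [hcut, ← convolution_mem_convolutionLanguage, ← convolution_take_append_drop x (by omega),
      ← hM, DFA.mem_accepts]
    have he' : M.eval ((convolution x).take (m + a)) = M.eval ((convolution x).take (m + b)) := he
    rw [DFA.eval, DFA.evalFrom_of_append, ← DFA.eval, he', DFA.eval, ← DFA.evalFrom_of_append,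
      List.take_append_drop]
    exact hacc
  · simp only [List.length_append, List.length_take, List.length_drop]; omega
  · simp only [List.length_append, List.length_take, List.length_drop]; omega

/-- An operation with regular graph increases lengths by at most an additive constant. -/
theorem exists_length_le_of_isRegularRelation_wordGraph {A : Type*} {D : Set (List A)} {k : ℕ}
    {f : (Fin k → D) → D} (hf : IsRegularRelation (wordGraph f)) :
    ∃ c : ℕ, ∀ (a : Fin k → D) (m : ℕ), (∀ i, (a i : List A).length ≤ m) →
      (f a : List A).length ≤ m + c := by
  obtain ⟨c, hc⟩ := hf.exists_pumping
  refine ⟨c, fun a m hm => ?_⟩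
  by_contra! h
  -- Pumping the output while keeping the arguments would give a second, shorter value of `f` at
  -- `a`.
  obtain ⟨y, ⟨b, hb⟩, -, hy⟩ := hc _ ⟨a, rfl⟩ (Fin.last k) m
    (fun i => Fin.lastCases (fun h => (h rfl).elim) (fun i _ => by simpa using hm i) i)
    (by simpa using h)
  rw [Fin.update_snoc_last] at hb
  have hab : b = a := by
    funext i
    have := congrFun hb i.castSucc
    simp only [Fin.snoc_castSucc] at this
    exact Subtype.ext this.symm
  have := congrFun hb (Fin.last k)
  simp only [Fin.snoc_last] at this
  subst hab
  rw [this] at hy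
  simp at hy

/-- Padding embeds these words into `Fin n → Option A`, whence the base `Nat.card A + 1`. -/
theorem ncard_length_le_le {A : Type*} [Finite A] (n : ℕ) :
    {w : List A | w.length ≤ n}.Finite ∧
      {w : List A | w.length ≤ n}.ncard ≤ (Nat.card A + 1) ^ n := by
  have hinj : Set.InjOn (fun (w : List A) (i : Fin n) => w[(i : ℕ)]?) {w : List A | w.length ≤ n} := by
    intro v hv w hw h
    refine List.ext_getElem? fun t => ?_
    by_cases ht : t < n
    · exact congrFun h ⟨t, ht⟩
    · simp only [Set.mem_ofPred_eq] at hv hw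
      rw [List.getElem?_eq_none (by omega), List.getElem?_eq_none (by omega)]
  have hfin := Set.Finite.of_finite_image (Set.toFinite _) hinj
  refine ⟨hfin, ?_⟩
  rw [← hinj.ncard_image]
  refine (Set.ncard_le_card _).trans ?_
  rw [Nat.card_fun, Finite.card_option, Nat.card_fin]

/-! ### Length functions on Boolean algebras -/

/-- The properties of word length in a word automatic presentation of a Boolean algebra. -/
structure IsTameLength {B : Type*} [BooleanAlgebra B] (ℓ : B → ℕ) (K c : ℕ) : Prop where
  finite : ∀ n, {b | ℓ b ≤ n}.Finite
  ncard_le : ∀ n, {b | ℓ b ≤ n}.ncard ≤ K ^ n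
  sup_le : ∀ {a b m}, ℓ a ≤ m → ℓ b ≤ m → ℓ (a ⊔ b) ≤ m + c
  split : ∀ {x m}, (Set.Iic x).Infinite → ℓ x ≤ m → ℓ ⊥ ≤ m →
    ∃ a b, a ≠ ⊥ ∧ b ≠ ⊥ ∧ Disjoint a b ∧ a ⊔ b = x ∧ ℓ a ≤ m + c ∧ ℓ b ≤ m + c

theorem IsWordAutomataPresentable.exists_isTameLength {B : Type*} [BooleanAlgebra B]
    (h : IsWordAutomataPresentable booleanLanguage B) :
    ∃ (ℓ : B → ℕ) (K c : ℕ), IsTameLength ℓ K c := by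
  obtain ⟨A, _, D, _, hD, ⟨e⟩⟩ := h
  set ℓ : B → ℕ := fun b => (e b : List A).length with hℓ
  have hsup : ∀ a b, e (a ⊔ b) = FirstOrder.Language.Structure.funMap
      (L := booleanLanguage) BooleanFunctions.sup ![e a, e b] := by
    intro a b
    exact (e.map_fun (BooleanFunctions.sup : booleanLanguage.Functions 2) ![a, b]).trans
      (congrArg _ (by funext i; fin_cases i <;> rfl))
  have hinf : ∀ a b, e (a ⊓ b) = FirstOrder.Language.Structure.funMap
      (L := booleanLanguage) BooleanFunctions.inf ![e a, e b] := by
    intro a b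
    exact (e.map_fun (BooleanFunctions.inf : booleanLanguage.Functions 2) ![a, b]).trans
      (congrArg _ (by funext i; fin_cases i <;> rfl))
  have hcompl : ∀ a, e aᶜ = FirstOrder.Language.Structure.funMap
      (L := booleanLanguage) BooleanFunctions.compl ![e a] := by
    intro a
    exact (e.map_fun (BooleanFunctions.compl : booleanLanguage.Functions 1) ![a]).trans
      (congrArg _ (by funext i; fin_cases i; rfl))
  obtain ⟨c₁, hc₁⟩ := exists_length_le_of_isRegularRelation_wordGraph
    (hD.operations 2 BooleanFunctions.sup)
  obtain ⟨c₂, hc₂⟩ := exists_length_le_of_isRegularRelation_wordGraph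
    (hD.operations 2 BooleanFunctions.inf)
  obtain ⟨c₃, hc₃⟩ := exists_length_le_of_isRegularRelation_wordGraph
    (hD.operations 1 BooleanFunctions.compl)
  obtain ⟨c₄, hc₄⟩ := (hD.operations 2 BooleanFunctions.sup).exists_pumping
  have hfin : ∀ n, {b | ℓ b ≤ n}.Finite := fun n =>
    (ncard_length_le_le (A := A) n).1.preimage (f := fun b => (e b : List A))
      (Subtype.val_injective.comp e.injective).injOn
  have hcard : ∀ n, {b | ℓ b ≤ n}.ncard ≤ (Nat.card A + 1) ^ n := fun n =>
    (Set.ncard_le_ncard_of_injOn (fun b => (e b : List A)) (fun b hb => hb)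
      (Subtype.val_injective.comp e.injective).injOn (ncard_length_le_le (A := A) n).1).trans
      (ncard_length_le_le (A := A) n).2
  refine ⟨ℓ, Nat.card A + 1, c₁ + c₂ + c₃ + c₄ + 1, hfin, hcard, ?_, ?_⟩
  · intro a b m ha hb
    have := hc₁ ![e a, e b] m (by simpa [Fin.forall_fin_two] using ⟨ha, hb⟩)
    rw [← hsup] at this
    simp only [hℓ]; omega
  · intro x m hx hxm hbot
    -- Take `a ≤ x` of least length exceeding `m`; its length alone shows `a ≠ ⊥` and `a ≠ x`. Were
    -- it much longer, pumping the first coordinate of `a ⊔ x = x` with threshold `m + 1` would give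
    -- a shorter element below `x`, still longer than `m`.
    have hne : ∃ n, ∃ a ≤ x, m < ℓ a ∧ ℓ a = n := by
      by_contra! hcon
      exact hx ((hfin m).subset fun a ha => not_lt.1 fun hlt => hcon _ a ha hlt rfl)
    classical
    obtain ⟨a, hax, ham, han⟩ := Nat.find_spec hne
    have hshort : ℓ a ≤ m + 1 + c₄ := by
      by_contra! hlong
      obtain ⟨y, ⟨b, hb⟩, hy1, hy2⟩ := hc₄ (Fin.snoc (fun i => (![e a, e x] i : List A)) (e x))
        ⟨![e a, e x], congrArg (Fin.snoc (α := fun _ => List A) _)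
          (congrArg Subtype.val ((congrArg e (sup_eq_right.2 hax)).symm.trans (hsup a x)))⟩ 0 (m + 1)
        (by
          intro i hi
          fin_cases i
          · exact (hi rfl).elim
          · exact hxm.trans (Nat.le_succ m)
          · exact hxm.trans (Nat.le_succ m)) hlong
      have h0 : y = (b 0 : List A) := congrFun hb 0
      have h1 : (e x : List A) = b 1 := congrFun hb 1
      have h2 : (e x : List A) = _ := congrFun hb 2
      obtain ⟨a', ha'⟩ := e.surjective (b 0)
      have hb' : b = ![e a', e x] := by
        funext i
        fin_cases i
        · exact ha'.symm
        · exact Subtype.ext h1.symm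
      have hle : a' ≤ x := by
        rw [← sup_eq_right]
        apply e.injective
        rw [hsup, ← hb']
        exact Subtype.ext h2.symm
      have hla : ℓ a' = y.length := by simp only [hℓ]; rw [h0, ha']
      have hlt : y.length < ℓ a := hy2
      exact Nat.find_min hne (m := ℓ a') (by omega) ⟨a', hle, by omega, rfl⟩
    have hax' : a ≠ x := by rintro rfl; omega
    have habot : a ≠ ⊥ := by rintro rfl; omega
    refine ⟨a, x \ a, habot, ?_, disjoint_sdiff_self_right, sup_sdiff_cancel_right hax, by omega, ?_⟩
    · rw [Ne, sdiff_eq_bot_iff]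
      exact fun h => hax' (le_antisymm hax h)
    · have h3 := hc₃ ![e a] (m + 1 + c₄) (by simpa using hshort)
      rw [← hcompl] at h3
      have h4 := hc₂ ![e x, e aᶜ] (m + 1 + c₄ + c₃)
        (by simpa [Fin.forall_fin_two] using ⟨by simp only [hℓ] at hxm; omega, h3⟩)
      rw [← hinf, ← sdiff_eq] at h4
      simp only [hℓ]; omega

section

variable {B : Type*} [BooleanAlgebra B]

theorem infinite_Iic_or_of_sup {a b : B} (h : (Set.Iic (a ⊔ b)).Infinite) :
    (Set.Iic a).Infinite ∨ (Set.Iic b).Infinite := by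
  by_contra hcon
  simp only [not_or, Set.not_infinite] at hcon
  refine h (((hcon.1.prod hcon.2).image fun p => p.1 ⊔ p.2).subset fun c hc => ?_)
  exact ⟨(c ⊓ a, c ⊓ b), ⟨inf_le_right, inf_le_right⟩, by
    simpa [← inf_sup_left] using hc⟩

theorem infinite_Iic_mono {a b : B} (h : a ≤ b) (ha : (Set.Iic a).Infinite) :
    (Set.Iic b).Infinite := ha.mono (Set.Iic_subset_Iic.2 h)

namespace IsTameLength

variable {ℓ : B → ℕ} {K c : ℕ}

theorem peel (h : IsTameLength ℓ K c)
    {x : B} {m : ℕ} (hx : (Set.Iic x).Infinite) (hm : ℓ x ≤ m) (hbot : ℓ ⊥ ≤ m) :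
    ∃ y z, (Set.Iic y).Infinite ∧ z ≠ ⊥ ∧ Disjoint y z ∧ y ≤ x ∧ z ≤ x ∧
      ℓ y ≤ m + c ∧ ℓ z ≤ m + c := by
  obtain ⟨a, b, ha, hb, hd, rfl, hla, hlb⟩ := h.split hx hm hbot
  rcases infinite_Iic_or_of_sup hx with hi | hi
  · exact ⟨a, b, hi, hb, hd, le_sup_left, le_sup_right, hla, hlb⟩
  · exact ⟨b, a, hi, ha, hd.symm, le_sup_right, le_sup_left, hlb, hla⟩

/-- Split repeatedly, setting one part aside and continuing with a part that still has infinitely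
many elements below it; each round costs `c`. -/
theorem exists_disjoint_pieces (h : IsTameLength ℓ K c)
    (n : ℕ) : ∀ {x : B} {m : ℕ}, (Set.Iic x).Infinite → ℓ x ≤ m →
    ℓ ⊥ ≤ m → ∃ z : Fin n → B, (∀ i, z i ≠ ⊥ ∧ z i ≤ x ∧ ℓ (z i) ≤ m + c * n) ∧
      Pairwise fun i j => Disjoint (z i) (z j) := by
  induction n with
  | zero => exact fun _ _ _ => ⟨Fin.elim0, fun i => i.elim0, fun i => i.elim0⟩
  | succ n ih =>
    intro x m hx hm hbot
    obtain ⟨y, w, hy, hw, hd, hyx, hwx, hly, hlw⟩ := h.peel hx hm hbot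
    obtain ⟨z, hz, hzd⟩ := ih hy hly (by omega)
    have hmul : c * (n + 1) = c * n + c := by ring
    refine ⟨Fin.cons w z, fun i => ?_, fun i j hij => ?_⟩
    · refine Fin.cases ⟨hw, hwx, ?_⟩ (fun i => ⟨(hz i).1, (hz i).2.1.trans hyx, ?_⟩) i
      · simp only [Fin.cons_zero]; omega
      · have := (hz i).2.2
        simp only [Fin.cons_succ]; omega
    · induction i using Fin.cases with
      | zero =>
        induction j using Fin.cases with
        | zero => exact (hij rfl).elim
        | succ j => exact (hd.mono_left (hz j).2.1).symm
      | succ i =>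
        induction j using Fin.cases with
        | zero => exact hd.mono_left (hz i).2.1
        | succ j => exact hzd fun hij' => hij (congrArg Fin.succ hij')

/-- Halving the index set arranges the join as a balanced binary tree of depth `r`, so the cost is
logarithmic in the number of terms. -/
theorem length_finset_sup_le (h : IsTameLength ℓ K c)
    {ι : Type*} {f : ι → B} {m : ℕ} (hf : ∀ i, ℓ (f i) ≤ m)
    (hbot : ℓ ⊥ ≤ m) (r : ℕ) : ∀ s : Finset ι, s.card ≤ 2 ^ r → ℓ (s.sup f) ≤ m + c * r := by
  classical
  induction r with
  | zero =>
    intro s hs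
    rcases s.eq_empty_or_nonempty with rfl | ⟨i, hi⟩
    · simpa using hbot
    · have := Finset.card_le_one.1 (by simpa using hs : s.card ≤ 1)
      rw [show s = {i} from Finset.eq_singleton_iff_unique_mem.2 ⟨hi, fun j hj => this j hj i hi⟩]
      simpa using hf i
  | succ r ih =>
    intro s hs
    obtain ⟨t, hts, ht⟩ := Finset.exists_subset_card_eq (s := s) (n := s.card / 2) (by omega)
    have hcard : (s \ t).card = s.card - s.card / 2 := by
      rw [Finset.card_sdiff_of_subset hts, ht]
    rw [pow_succ] at hs
    have := h.sup_le (ih t (by omega)) (ih (s \ t) (by omega))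
    rw [← Finset.sup_union, Finset.union_sdiff_of_subset hts] at this
    rw [mul_add]; omega

end IsTameLength

/-- The index set is recovered from the join: it consists of those `i` with `f i` below it. -/
theorem finset_sup_injective_of_disjoint {ι : Type*} {f : ι → B} (hne : ∀ i, f i ≠ ⊥)
    (hd : Pairwise fun i j => Disjoint (f i) (f j)) :
    Function.Injective fun s : Finset ι => s.sup f := by
  have key : ∀ (s : Finset ι) i, i ∈ s ↔ f i ≤ s.sup f := by
    intro s i
    refine ⟨fun hi => Finset.le_sup hi, fun hi => ?_⟩
    by_contra his
    refine hne i (disjoint_self.1 (Disjoint.mono_right hi ?_))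
    exact (Finset.disjoint_sup_right).2 fun j hj => hd (by rintro rfl; exact his hj)
  intro s t hst
  ext i
  rw [key, key, show s.sup f = t.sup f from hst]

/-- A tame length bounds the number of disjoint elements with infinitely many elements below. -/
theorem IsTameLength.exists_bound {ℓ : B → ℕ} {K c : ℕ} (h : IsTameLength ℓ K c) :
    ∃ N : ℕ, ¬ ∃ x : Fin N → B, (∀ i, (Set.Iic (x i)).Infinite) ∧
      Pairwise fun i j => Disjoint (x i) (x j) := by
  obtain ⟨q, hq⟩ : ∃ q, K ≤ 2 ^ q := ⟨K, Nat.lt_two_pow_self.le⟩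
  -- There are at most `2 ^ (q * M)` elements of length at most `M`, and the main term of `M` will
  -- be `c * 2 ^ r`; this choice ensures `q * c < s ≤ 2 ^ s`.
  set s := q * c + 1 with hs
  refine ⟨2 ^ s, ?_⟩
  rintro ⟨x, hx, hxd⟩
  obtain ⟨m, hm⟩ : ∃ m, (∀ i, ℓ (x i) ≤ m) ∧ ℓ ⊥ ≤ m := by
    refine ⟨Finset.univ.sup (fun i => ℓ (x i)) + ℓ ⊥, fun i => ?_, Nat.le_add_left _ _⟩
    exact (Finset.le_sup (f := fun i => ℓ (x i)) (Finset.mem_univ i)).trans (Nat.le_add_right _ _)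
  obtain ⟨r, hr⟩ : ∃ r, q * (m + c * (s + r)) < 2 ^ r := by
    set u := q * (m + c * s) + 2 * (q * c) with hu
    -- With `r = 2 * u` the left side is at most `u + u * u`, while `2 ^ r ≥ (u + 1) * (u + 1)`.
    refine ⟨u + u, ?_⟩
    have h1 : u + 1 ≤ 2 ^ u := Nat.lt_two_pow_self
    have h2 := Nat.mul_le_mul h1 h1
    rw [pow_add]
    refine lt_of_lt_of_le ?_ h2
    nlinarith [Nat.zero_le (q * (m + c * s) * u)]
  choose z hz hzd using fun i => h.exists_disjoint_pieces (2 ^ r) (hx i) (hm.1 i) hm.2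
  have hinj := finset_sup_injective_of_disjoint (f := fun p : Fin (2 ^ s) × Fin (2 ^ r) => z p.1 p.2)
    (fun p => (hz p.1 p.2).1) (by
      rintro ⟨i, a⟩ ⟨j, b⟩ hne
      by_cases hij : i = j
      · subst hij
        exact hzd i fun hab => hne (congrArg (Prod.mk i) hab)
      · exact (hxd hij).mono (hz i a).2.1 (hz j b).2.1)
  set M := m + c * 2 ^ r + c * (s + r) with hM
  have hlen : ∀ t : Finset (Fin (2 ^ s) × Fin (2 ^ r)), ℓ (t.sup fun p => z p.1 p.2) ≤ M := by
    intro t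
    refine h.length_finset_sup_le (fun p => (hz p.1 p.2).2.2) (hm.2.trans (Nat.le_add_right _ _))
      (s + r) t ((Finset.card_le_univ t).trans ?_)
    simp [pow_add]
  have hcount : 2 ^ (2 ^ s * 2 ^ r) ≤ K ^ M := by
    refine le_trans ?_ (h.ncard_le M)
    have := Set.ncard_le_ncard_of_injOn (s := Set.univ) (t := {b | ℓ b ≤ M}) _
      (fun t _ => hlen t) hinj.injOn (h.finite M)
    simpa [Set.ncard_univ] using this
  have h1 : 2 ^ s * 2 ^ r ≤ q * M := by
    have := hcount.trans (Nat.pow_le_pow_left hq M)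
    rw [← pow_mul] at this
    exact (Nat.pow_le_pow_iff_right (by norm_num)).1 this
  have h2 : s * 2 ^ r ≤ 2 ^ s * 2 ^ r := Nat.mul_le_mul_right _ Nat.lt_two_pow_self.le
  have h3 : s * 2 ^ r = q * (c * 2 ^ r) + 2 ^ r := by rw [hs]; ring
  have h4 : q * M = q * (c * 2 ^ r) + q * (m + c * (s + r)) := by rw [hM]; ring
  omega

end

/-! ### Boolean algebras with boundedly many disjoint infinite elements -/

section

variable {B : Type*} [BooleanAlgebra B]

theorem IsAtom.le_or_disjoint {a : B} (ha : IsAtom a) (b : B) : a ≤ b ∨ Disjoint a b := by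
  rcases ha.le_iff.1 (inf_le_left : a ⊓ b ≤ a) with h | h
  · exact Or.inr (disjoint_iff.2 h)
  · exact Or.inl (inf_eq_left.1 h)

theorem IsAtom.exists_le_of_le_finset_sup {ι : Type*} {a : B} (ha : IsAtom a) {s : Finset ι}
    {f : ι → B} (h : a ≤ s.sup f) : ∃ i ∈ s, a ≤ f i := by
  by_contra! hcon
  refine ha.1 (disjoint_self.1 (Disjoint.mono_right h ?_))
  exact Finset.disjoint_sup_right.2 fun i hi => (ha.le_or_disjoint (f i)).resolve_left (hcon i hi)

theorem exists_isAtom_le_of_finite_Iic {a : B} (hfin : (Set.Iic a).Finite) (ha : a ≠ ⊥) :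
    ∃ b, IsAtom b ∧ b ≤ a := by
  have := hfin.to_subtype
  rcases eq_bot_or_exists_atom_le (⊤ : Set.Iic a) with h | ⟨b, hb, -⟩
  · exact (ha (congrArg Subtype.val h)).elim
  · exact ⟨b, hb.of_isAtom_coe_Iic, b.2⟩

theorem finite_Iic_sup {a b : B} (ha : (Set.Iic a).Finite) (hb : (Set.Iic b).Finite) :
    (Set.Iic (a ⊔ b)).Finite := by
  by_contra h
  exact (infinite_Iic_or_of_sup h).elim (fun h => h ha) (fun h => h hb)

theorem finite_Iic_finset_sup {ι : Type*} {f : ι → B} (s : Finset ι)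
    (h : ∀ i ∈ s, (Set.Iic (f i)).Finite) : (Set.Iic (s.sup f)).Finite :=
  Finset.sup_induction (p := fun b => (Set.Iic b).Finite) (by simp)
    (fun _ ha _ hb => finite_Iic_sup ha hb) h

/-- An element with infinitely many elements below that is not a join of two such disjoint
elements. -/
structure IsIndecomposable (x : B) : Prop where
  infinite : (Set.Iic x).Infinite
  finite_or : ∀ a, (Set.Iic (x ⊓ a)).Finite ∨ (Set.Iic (x \ a)).Finite

/-- If there were finitely many, removing their join `s` would leave an infinite part `x \ s`
without atoms. Every nonzero element below it would then have infinitely many elements below, so any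
proper nonzero `c ≤ x \ s` would decompose `x`. -/
theorem IsIndecomposable.infinite_atoms {x : B} (hx : IsIndecomposable x) :
    {a | IsAtom a ∧ a ≤ x}.Infinite := by
  intro hS
  set s := hS.toFinset.sup id with hs
  have hsfin : (Set.Iic s).Finite := by
    refine finite_Iic_finset_sup _ fun a ha => ?_
    have ha' : IsAtom a := (hS.mem_toFinset.1 ha).1
    exact ((Set.finite_singleton a).insert ⊥).subset fun b hb => ha'.le_iff.1 hb
  have hy : (Set.Iic (x \ s)).Infinite := by
    have := infinite_Iic_mono (b := s ⊔ x \ s) (by simp) hx.infinite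
    exact (infinite_Iic_or_of_sup this).resolve_left fun h => h hsfin
  have key : ∀ d, d ≤ x \ s → d ≠ ⊥ → ¬ (Set.Iic d).Finite := by
    intro d hd hne hfin
    obtain ⟨b, hb, hbd⟩ := exists_isAtom_le_of_finite_Iic hfin hne
    have hbs : b ≤ s := Finset.le_sup (f := id)
      (hS.mem_toFinset.2 ⟨hb, (hbd.trans hd).trans sdiff_le⟩)
    exact hb.1 (disjoint_self.1 (disjoint_sdiff_self_right.mono hbs (hbd.trans hd)))
  obtain ⟨c, hc, hne⟩ := (hy.sdiff ((Set.finite_singleton (x \ s)).insert ⊥)).nonempty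
  simp only [Set.mem_insert_iff, Set.mem_singleton_iff, not_or, Set.mem_Iic] at hne hc
  rcases hx.finite_or c with h | h
  · exact key c hc hne.1 (h.subset (Set.Iic_subset_Iic.2 (le_inf (hc.trans sdiff_le) le_rfl)))
  · refine key ((x \ s) \ c) sdiff_le ?_
      (h.subset (Set.Iic_subset_Iic.2 (sdiff_le_sdiff_right sdiff_le)))
    rw [Ne, sdiff_eq_bot_iff]
    exact fun h => hne.2 (le_antisymm hc h)

/-- If `c` has infinitely many elements below it, then `x \ c` has only finitely many and cannot
hold all the atoms below `x`. -/
theorem IsIndecomposable.exists_isAtom_le {x c : B} (hx : IsIndecomposable x) (hcx : c ≤ x)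
    (hc : c ≠ ⊥) : ∃ a, IsAtom a ∧ a ≤ c := by
  by_cases hfin : (Set.Iic c).Finite
  · exact exists_isAtom_le_of_finite_Iic hfin hc
  have hfin' : (Set.Iic (x \ c)).Finite := by
    refine (hx.finite_or c).resolve_left fun h => hfin ?_
    rwa [inf_eq_right.2 hcx] at h
  by_contra! hcon
  refine hx.infinite_atoms (hfin'.subset fun a ha => ?_)
  exact le_sdiff.2 ⟨ha.2, (ha.1.le_or_disjoint c).resolve_left (hcon a ha.1)⟩

/-- A disjoint family of infinite elements of maximal size works: a decomposable member could be
replaced by its two parts, giving a larger family. -/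
theorem exists_partition_isIndecomposable [Infinite B] {N : ℕ}
    (hN : ¬ ∃ x : Fin N → B, (∀ i, (Set.Iic (x i)).Infinite) ∧
      Pairwise fun i j => Disjoint (x i) (x j)) :
    ∃ (n : ℕ) (x : Fin n → B), 1 ≤ n ∧ (∀ i, IsIndecomposable (x i)) ∧
      (Pairwise fun i j => Disjoint (x i) (x j)) ∧ Finset.univ.sup x = ⊤ := by
  classical
  have hex : ∃ N : ℕ, ¬ ∃ x : Fin N → B, (∀ i, (Set.Iic (x i)).Infinite) ∧
      Pairwise fun i j => Disjoint (x i) (x j) := ⟨N, hN⟩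
  have htop : (Set.Iic (⊤ : B)).Infinite := by
    rw [Set.Iic_top]; exact Set.infinite_univ
  obtain ⟨n, hn⟩ : ∃ n, Nat.find hex = n + 2 := by
    have h0 : Nat.find hex ≠ 0 := fun h0 => by
      have := Nat.find_spec hex
      rw [h0] at this
      exact this ⟨Fin.elim0, fun i => i.elim0, fun i => i.elim0⟩
    have h1 : Nat.find hex ≠ 1 := fun h1 => by
      have := Nat.find_spec hex
      rw [h1] at this
      exact this ⟨fun _ => ⊤, fun _ => htop, fun i j hij => (hij (Subsingleton.elim i j)).elim⟩
    exact ⟨Nat.find hex - 2, by omega⟩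
  have hmax := Nat.find_spec hex
  rw [hn] at hmax
  obtain ⟨y, hy, hyd⟩ := not_not.1 (Nat.find_min hex (m := n + 1) (by omega))
  set r := (Finset.univ.sup y)ᶜ with hr
  have hyr : ∀ i, Disjoint (y i) r := fun i =>
    disjoint_compl_right.mono_left (Finset.le_sup (Finset.mem_univ i))
  -- The first member absorbs whatever the family does not cover.
  set x := Function.update y 0 (y 0 ⊔ r) with hx
  have hyx : ∀ i, y i ≤ x i := by
    intro i
    by_cases hi : i = 0
    · subst hi; simp [hx]
    · simp [hx, hi]
  have hxd : Pairwise fun i j => Disjoint (x i) (x j) := by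
    intro i j hij
    by_cases hi : i = 0
    · subst hi
      have hj : j ≠ 0 := hij.symm
      simp only [hx, Function.update_self, Function.update_of_ne hj]
      exact (hyd hij).sup_left (hyr j).symm
    · by_cases hj : j = 0
      · subst hj
        simp only [hx, Function.update_self, Function.update_of_ne hi]
        exact (hyd hij).sup_right (hyr i)
      · simp only [hx, Function.update_of_ne hi, Function.update_of_ne hj]
        exact hyd hij
  refine ⟨n + 1, x, by omega, fun i => ⟨infinite_Iic_mono (hyx i) (hy i), fun a => ?_⟩, hxd, ?_⟩
  · by_contra! hcon
    refine hmax ⟨Fin.cons (x i \ a) (Function.update x i (x i ⊓ a)), ?_, ?_⟩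
    · intro j
      refine Fin.cases ?_ (fun j => ?_) j
      · simpa using hcon.2
      · rw [Fin.cons_succ]
        by_cases hj : j = i
        · subst hj; simpa using hcon.1
        · rw [Function.update_of_ne hj]
          exact infinite_Iic_mono (hyx j) (hy j)
    · have hle : ∀ j, Function.update x i (x i ⊓ a) j ≤ x j := by
        intro j
        by_cases hj : j = i
        · subst hj; simp
        · simp [hj]
      have hnew : ∀ j, Disjoint (x i \ a) (Function.update x i (x i ⊓ a) j) := by
        intro j
        by_cases hj : j = i
        · subst hj
          rw [Function.update_self]
          exact disjoint_sdiff_self_left.mono_right inf_le_right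
        · exact (hxd (Ne.symm hj)).mono sdiff_le (hle j)
      intro j k hjk
      induction j using Fin.cases with
      | zero =>
        induction k using Fin.cases with
        | zero => exact (hjk rfl).elim
        | succ k => exact hnew k
      | succ j =>
        induction k using Fin.cases with
        | zero => exact (hnew j).symm
        | succ k =>
          exact (hxd fun h => hjk (congrArg Fin.succ h)).mono (hle j) (hle k)
  · rw [eq_top_iff, ← sup_compl_eq_top (x := Finset.univ.sup y)]
    refine sup_le (Finset.sup_mono_fun fun i _ => hyx i) ?_
    refine le_trans ?_ (Finset.le_sup (Finset.mem_univ (0 : Fin (n + 1))))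
    simp [hx, ← hr]

/-- Countably many atoms below an element realize all finite or cofinite sets. -/
theorem exists_le_forall_atom_le_iff_mem {x : B} {a : ℕ → B} (hatom : ∀ m, IsAtom (a m))
    (hle : ∀ m, a m ≤ x) (ha : Function.Injective a) (S : finiteCofinite) :
    ∃ b ≤ x, ∀ m, a m ≤ b ↔ m ∈ (S : Set ℕ) := by
  have key : ∀ T : Finset ℕ, ∀ m, a m ≤ T.sup a ↔ m ∈ T := by
    refine fun T m => ⟨fun h => ?_, fun h => Finset.le_sup h⟩
    obtain ⟨i, hi, hmi⟩ := (hatom m).exists_le_of_le_finset_sup h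
    rcases (hatom i).le_iff.1 hmi with h | h
    · exact ((hatom m).1 h).elim
    · rwa [ha h]
  rcases S.2 with hS | hS
  · exact ⟨hS.toFinset.sup a, Finset.sup_le fun i _ => hle i, fun m => by simp [key]⟩
  · refine ⟨x \ hS.toFinset.sup a, sdiff_le, fun m => ?_⟩
    have := key hS.toFinset m
    simp only [Set.Finite.mem_toFinset, Set.mem_compl_iff] at this
    rw [le_sdiff, ← not_iff_not, ← this, not_and]
    constructor
    · exact fun h => ((hatom m).le_or_disjoint _).resolve_right (h (hle m))
    · exact fun h _ hd => (hatom m).1 (disjoint_self.1 (hd.mono_right h))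

/-- Send `b` to the sets of atoms below `b` in each block. Indecomposability makes these sets finite
or cofinite, and an atom below a nonzero part of `b \ c` shows that the order is reflected.
Countability lets `ℕ` index the atoms. -/
theorem nonempty_orderIso_of_partition [Countable B] {n : ℕ} {x : Fin n → B}
    (hx : ∀ i, IsIndecomposable (x i)) (hd : Pairwise fun i j => Disjoint (x i) (x j))
    (htop : Finset.univ.sup x = ⊤) : Nonempty (B ≃o (Fin n → finiteCofinite)) := by
  have he : ∀ i, Nonempty (ℕ ≃ {a | IsAtom a ∧ a ≤ x i}) := fun i =>
    have := (hx i).infinite_atoms.to_subtype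
    nonempty_equiv_of_countable
  let e := fun i => (he i).some
  set a : Fin n → ℕ → B := fun i m => e i m with ha
  have hatom : ∀ i m, IsAtom (a i m) := fun i m => (e i m).2.1
  have hle : ∀ i m, a i m ≤ x i := fun i m => (e i m).2.2
  have hinj : ∀ i, Function.Injective (a i) := fun i => Subtype.val_injective.comp (e i).injective
  have hmem : ∀ b i, {m | a i m ≤ b} ∈ finiteCofinite := by
    intro b i
    rcases (hx i).finite_or b with h | h
    · exact Or.inl ((h.preimage (hinj i).injOn).subset fun m hm => le_inf (hle i m) hm)
    · refine Or.inr ((h.preimage (hinj i).injOn).subset fun m hm => ?_)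
      exact le_sdiff.2 ⟨hle i m, ((hatom i m).le_or_disjoint b).resolve_left hm⟩
  let φ : B → Fin n → finiteCofinite := fun b i => ⟨{m | a i m ≤ b}, hmem b i⟩
  have hφ : ∀ b c, φ b ≤ φ c ↔ b ≤ c := by
    refine fun b c => ⟨fun h => ?_, fun h i m hm => le_trans hm h⟩
    by_contra hbc
    obtain ⟨i, hi⟩ : ∃ i, x i ⊓ b \ c ≠ ⊥ := by
      by_contra! hcon
      refine hbc (sdiff_eq_bot_iff.1 ?_)
      rw [← top_inf_eq (b \ c), ← htop, Finset.sup_inf_distrib_right]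
      exact (Finset.sup_congr rfl fun i _ => hcon i).trans (Finset.sup_bot _)
    obtain ⟨d, hdatom, hdle⟩ := (hx i).exists_isAtom_le inf_le_left hi
    obtain ⟨m, hm⟩ := (e i).surjective ⟨d, hdatom, hdle.trans inf_le_left⟩
    have hm' : a i m = d := congrArg Subtype.val hm
    have hdb : d ≤ b \ c := hdle.trans inf_le_right
    have hmc : a i m ≤ c := h i (show a i m ≤ b from hm' ▸ hdb.trans sdiff_le)
    rw [hm'] at hmc
    exact hdatom.1 (disjoint_self.1 ((le_sdiff.1 hdb).2.mono_right hmc))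
  have hsurj : Function.Surjective φ := by
    intro S
    choose b hbx hb using fun i =>
      exists_le_forall_atom_le_iff_mem (hatom i) (hle i) (hinj i) (S i)
    refine ⟨Finset.univ.sup b, ?_⟩
    funext i
    refine Subtype.ext (Set.ext fun m => ?_)
    rw [← hb i m]
    refine ⟨fun h => ?_, fun h => h.trans (Finset.le_sup (Finset.mem_univ i))⟩
    obtain ⟨j, -, hj⟩ := (hatom i m).exists_le_of_le_finset_sup h
    by_cases hij : i = j
    · exact hij ▸ hj
    · exact ((hatom i m).1 (disjoint_self.1 ((hd hij).mono (hle i m) (hj.trans (hbx j))))).elim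
  let ψ : B ↪o (Fin n → finiteCofinite) := OrderEmbedding.ofMapLEIff φ hφ
  exact ⟨RelIso.ofSurjective ψ hsurj⟩

end

/-- An order isomorphism of Boolean algebras is an isomorphism of structures. -/
def OrderIso.toBooleanLanguageEquiv {B C : Type*} [BooleanAlgebra B] [BooleanAlgebra C]
    (e : B ≃o C) : booleanLanguage.Equiv B C where
  toEquiv := e.toEquiv
  map_fun' := by
    intro n f x
    change BooleanFunctions n at f
    cases f
    · exact e.map_bot
    · exact e.map_top
    · exact map_compl' e (x 0)
    · exact e.map_sup (x 0) (x 1)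
    · exact e.map_inf (x 0) (x 1)
  map_rel' := fun r => r.elim

theorem IsWordAutomataPresentable.finite_or_nonempty_equiv {B : Type*} [BooleanAlgebra B]
    (h : IsWordAutomataPresentable booleanLanguage B) :
    Finite B ∨ ∃ n : ℕ, 1 ≤ n ∧ Nonempty (booleanLanguage.Equiv B (Fin n → finiteCofinite)) := by
  rcases finite_or_infinite B with hB | hB
  · exact Or.inl hB
  obtain ⟨ℓ, K, c, hℓ⟩ := h.exists_isTameLength
  have : Countable B := by
    rw [← Set.countable_univ_iff]
    exact (Set.countable_iUnion fun n => (hℓ.finite n).countable).mono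
      fun b _ => Set.mem_iUnion.2 ⟨ℓ b, le_refl (ℓ b)⟩
  obtain ⟨N, hN⟩ := hℓ.exists_bound
  obtain ⟨n, x, hn, hx, hd, htop⟩ := exists_partition_isIndecomposable hN
  obtain ⟨e⟩ := nonempty_orderIso_of_partition hx hd htop
  exact Or.inr ⟨n, hn, ⟨e.toBooleanLanguageEquiv⟩⟩

/-! ### Regularity of local languages and relations -/

theorem Language.isRegular_of_finite {α : Type*} {L : _root_.Language α}
    (hL : Set.Finite (L : Set (List α))) : L.IsRegular := by
  refine _root_.Language.IsRegular.of_finite_range_leftQuotient ?_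
  have hfin : (⋃ w ∈ (L : Set (List α)), {y | y ∈ w.tails}).Finite :=
    hL.biUnion fun w _ => w.tails.finite_toSet
  refine hfin.powerset.subset ?_
  rintro _ ⟨x, rfl⟩ y hy
  exact Set.mem_biUnion hy ((List.mem_tails _ _).2 (List.suffix_append x y))

/-- Languages given by conditions on the first letter and on adjacent letters, `none` standing for
the end of the word, are regular. -/
theorem Language.isRegular_of_local {α ι : Type*} [Finite α] [Finite ι] (P : ι → Option α → Prop)
    (Q : ι → Option α → Option α → Prop) :
    _root_.Language.IsRegular (T := α)
      {w : List α | ∃ c, P c w[0]? ∧ ∀ i : ℕ, Q c w[i]? w[i + 1]?} := by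
  set L : _root_.Language α := {w : List α | ∃ c, P c w[0]? ∧ ∀ i : ℕ, Q c w[i]? w[i + 1]?} with hL
  refine _root_.Language.IsRegular.of_finite_range_leftQuotient ?_
  -- A left quotient by a nonempty word depends only on its last letter and on the set of parameters
  -- `c` not yet refuted, so there are finitely many quotients.
  let F : Set ι × α → _root_.Language α := fun p =>
    {y : List α | ∃ c ∈ p.1, ∀ i : ℕ, Q c (p.2 :: y)[i]? (p.2 :: y)[i + 1]?}
  refine ((Set.finite_range F).insert L).subset ?_
  rintro _ ⟨x, rfl⟩
  induction x using List.reverseRecOn with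
  | nil => exact Or.inl rfl
  | append_singleton x a _ =>
    refine Or.inr ⟨({c | P c (x ++ [a])[0]? ∧ ∀ i < x.length,
      Q c (x ++ [a])[i]? (x ++ [a])[i + 1]?}, a), ?_⟩
    have h1 : ∀ (y : List α) (i : ℕ), i ≤ x.length → (x ++ [a] ++ y)[i]? = (x ++ [a])[i]? :=
      fun y i hi => List.getElem?_append_left (by simp; omega)
    have h2 : ∀ (y : List α) (i : ℕ), (x ++ [a] ++ y)[x.length + i]? = (a :: y)[i]? := by
      intro y i
      rw [List.append_assoc, List.getElem?_append_right (by omega), Nat.add_sub_cancel_left]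
      rfl
    refine Set.ext fun y => ?_
    change (∃ c, (P c _ ∧ ∀ i < x.length, _) ∧ _) ↔ (∃ c, P c (x ++ [a] ++ y)[0]? ∧ _)
    refine exists_congr fun c => ?_
    rw [and_assoc, h1 y 0 (Nat.zero_le _)]
    refine and_congr_right fun _ => ⟨fun h i => ?_, fun h => ⟨fun i hi => ?_, fun i => ?_⟩⟩
    · by_cases hi : i < x.length
      · rw [h1 y i hi.le, h1 y (i + 1) hi]
        exact h.1 i hi
      · obtain ⟨t, rfl⟩ := Nat.exists_eq_add_of_le (not_lt.1 hi)
        rw [add_assoc, h2, h2]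
        exact h.2 t
    · rw [← h1 y i hi.le, ← h1 y (i + 1) hi]
      exact h i
    · rw [← h2, ← h2]
      exact h (x.length + i)

theorem exists_list_getElem?_eq {A : Type*} (n : ℕ) : ∀ f : ℕ → Option A,
    (∀ t, f t = none → f (t + 1) = none) → f n = none → ∃ l : List A, ∀ t : ℕ, l[t]? = f t := by
  have nil : ∀ f : ℕ → Option A, (∀ t, f t = none → f (t + 1) = none) → f 0 = none →
      ∃ l : List A, ∀ t : ℕ, l[t]? = f t := by
    refine fun f hf h0 => ⟨[], fun t => ?_⟩
    induction t with
    | zero => exact h0.symm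
    | succ t ih => exact (hf t ih.symm).symm
  induction n with
  | zero => exact nil
  | succ n ih =>
    intro f hf hn
    rcases h0 : f 0 with _ | a
    · exact nil f hf h0
    · obtain ⟨l, hl⟩ := ih (fun t => f (t + 1)) (fun t => hf (t + 1)) hn
      refine ⟨a :: l, fun t => ?_⟩
      cases t with
      | zero => exact h0.symm
      | succ t => simpa using hl t

/-- Being a convolution is itself local: no letter is all padding, and a padded component stays
padded. -/
theorem isRegularRelation_of_local {A ι : Type*} [Finite A] [Finite ι] {k : ℕ}
    {R : Set (Fin k → List A)} (P : ι → (Fin k → Option A) → Prop)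
    (Q : ι → (Fin k → Option A) → (Fin k → Option A) → Prop)
    (hR : ∀ x, x ∈ R ↔ ∃ c, P c (fun j => (x j)[0]?) ∧
      ∀ i : ℕ, Q c (fun j => (x j)[i]?) (fun j => (x j)[i + 1]?)) : IsRegularRelation R := by
  -- The end of the convolution is read as padding in every component.
  let tr : Option (Fin k → Option A) → Fin k → Option A := fun u j => u.bind fun a => a j
  have h := Language.isRegular_of_local
    (fun (c : ι) (u : Option (Fin k → Option A)) => P c (tr u) ∧ u ≠ some fun _ => none)
    (fun c u v => Q c (tr u) (tr v) ∧ (v ≠ some fun _ => none) ∧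
      ∀ j, tr u j = none → tr v j = none)
  refine (congrArg _root_.Language.IsRegular ?_).mp h
  refine Set.ext fun w => ⟨?_, ?_⟩
  · rintro ⟨c, ⟨hP, h0⟩, hQ⟩
    choose x hx using fun j => exists_list_getElem?_eq w.length (fun t => tr w[t]? j)
      (fun t => (hQ t).2.2 j) (by simp [tr])
    have hx' : ∀ t : ℕ, tr w[t]? = fun j => (x j)[t]? := fun t => funext fun j => (hx j t).symm
    refine ⟨x, (hR x).2 ⟨c, hx' 0 ▸ hP, fun i => ?_⟩, ?_⟩
    · rw [← hx', ← hx']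
      exact (hQ i).1
    · symm
      rw [eq_convolution_iff]
      refine ⟨fun t l => (hx l t).symm, fun t => ?_⟩
      cases t with
      | zero => exact h0
      | succ t => exact (hQ t).2.1
  · rintro ⟨x, hx, rfl⟩
    have htr : ∀ t : ℕ, tr (convolution x)[t]? = fun j => (x j)[t]? :=
      fun t => funext fun j => convolution_getElem?_bind x t j
    obtain ⟨c, hP, hQ⟩ := (hR x).1 hx
    refine ⟨c, ⟨by rwa [htr], convolution_getElem?_ne x 0⟩, fun i =>
      ⟨by rw [htr, htr]; exact hQ i, convolution_getElem?_ne x (i + 1), fun j => ?_⟩⟩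
    rw [htr, htr]
    simp only [List.getElem?_eq_none_iff]
    omega

/-! ### Presentations of Boolean algebras -/

theorem IsWordAutomataPresentable.of_encoding {B : Type*} [BooleanAlgebra B] {A : Type} [Finite A]
    (enc : B → List A) (hinj : Function.Injective enc)
    (hdom : _root_.Language.IsRegular (T := A) (Set.range enc))
    (hop : ∀ (k : ℕ) (f : booleanLanguage.Functions k), IsRegularRelation
      {x | ∃ a : Fin k → B, x = Fin.snoc (fun i => enc (a i))
        (enc (FirstOrder.Language.Structure.funMap f a))}) :
    IsWordAutomataPresentable booleanLanguage B := by
  let e : B ≃ Set.range enc := Equiv.ofInjective enc hinj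
  let : booleanLanguage.Structure (Set.range enc) := e.inducedStructure
  refine ⟨A, inferInstance, Set.range enc, inferInstance, ⟨hdom, fun k f => ?_, fun k r => r.elim⟩,
    ⟨e.inducedStructureEquiv⟩⟩
  refine (congrArg IsRegularRelation (Set.ext fun x => ⟨?_, ?_⟩)).mp (hop k f)
  · rintro ⟨a, rfl⟩
    refine ⟨fun i => e (a i), ?_⟩
    have : (FirstOrder.Language.Structure.funMap f fun i => e (a i)) =
        e (FirstOrder.Language.Structure.funMap f a) :=
      (e.inducedStructureEquiv.map_fun f a).symm
    simp only [this]
    rfl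
  · rintro ⟨b, rfl⟩
    obtain ⟨a, rfl⟩ : ∃ a : Fin k → B, b = fun i => e (a i) :=
      ⟨fun i => e.symm (b i), by simp⟩
    refine ⟨a, ?_⟩
    have : (FirstOrder.Language.Structure.funMap f fun i => e (a i)) =
        e (FirstOrder.Language.Structure.funMap f a) :=
      (e.inducedStructureEquiv.map_fun f a).symm
    simp only [this]
    rfl

theorem IsWordAutomataPresentable.of_finite (B : Type*) [BooleanAlgebra B] [Finite B] :
    IsWordAutomataPresentable booleanLanguage B := by
  let e := Finite.equivFin B
  refine .of_encoding (fun b => [e b]) (fun a b h => e.injective (by simpa using h))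
    (Language.isRegular_of_finite (Set.finite_range _)) fun k f => ?_
  refine Language.isRegular_of_finite (Set.Finite.image _ ?_)
  refine (Set.finite_range fun a : Fin k → B => (Fin.snoc (fun i => [e (a i)])
    [e (FirstOrder.Language.Structure.funMap f a)] : Fin (k + 1) → List _)).subset ?_
  rintro _ ⟨a, rfl⟩
  exact ⟨a, rfl⟩

theorem IsWordAutomataPresentable.of_equiv {L : FirstOrder.Language} {M N : Type*} [L.Structure M]
    [L.Structure N] (e : L.Equiv M N) (h : IsWordAutomataPresentable L N) :
    IsWordAutomataPresentable L M := by
  obtain ⟨A, hA, D, hD, h, ⟨e'⟩⟩ := h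
  exact ⟨A, hA, D, hD, h, ⟨e'.comp e⟩⟩

/-! ### Encoding eventually constant sequences -/

section

variable {A : Type*}

/-- The value coded by a letter at a position of a word with tail value `c`. -/
def codeValue (c : A) : Option (A ⊕ A) → A
  | some (Sum.inr a) => a
  | _ => c

/-- The condition on adjacent letters in the code of a sequence with tail value `c`. -/
def IsCodeStep (c : A) (u v : Option (A ⊕ A)) : Prop :=
  (∀ a, v ≠ some (Sum.inl a)) ∧ (u = some (Sum.inr c) → v ≠ none)

/-- `w` is the code of the sequence `s`, whose value is eventually `c`. -/
def IsSequenceCode (c : A) (s : ℕ → A) (w : List (A ⊕ A)) : Prop :=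
  w[0]? = some (Sum.inl c) ∧ ∀ i : ℕ, IsCodeStep c w[i]? w[i + 1]? ∧ s i = codeValue c w[i + 1]?

/-- Use the shortest prefix after which `s` is constant; minimality keeps its last letter different
from `c`. The leading letter shifts `s i` to position `i + 1`. -/
theorem exists_isSequenceCode {c : A} {s : ℕ → A} (h : ∃ m, ∀ i ≥ m, s i = c) :
    ∃ w, IsSequenceCode c s w := by
  classical
  set m := Nat.find h with hm
  have hget : ∀ i : ℕ, (Sum.inl c :: (List.range m).map (fun i => (Sum.inr (s i) : A ⊕ A)))[i + 1]? =
      if i < m then some (Sum.inr (s i)) else none := by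
    intro i
    rw [List.getElem?_cons_succ, List.getElem?_map]
    split_ifs with hi
    · simp [hi]
    · simp [hi]
  refine ⟨Sum.inl c :: (List.range m).map (fun i => Sum.inr (s i)), rfl, fun i => ⟨⟨?_, ?_⟩, ?_⟩⟩
  · intro a
    rw [hget]
    split_ifs <;> simp
  · intro hu hv
    rw [hget] at hv
    cases i with
    | zero => simp at hu
    | succ i =>
      rw [hget] at hu
      split_ifs at hu hv with h1 h2
      have hsi : s i = c := by simpa using hu
      refine Nat.find_min h h1 fun t ht => ?_
      rcases eq_or_lt_of_le ht with rfl | ht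
      · exact hsi
      · exact Nat.find_spec h t (by omega)
  · rw [hget]
    split_ifs with hi
    · rfl
    · exact Nat.find_spec h i (by omega)

theorem IsSequenceCode.exists_forall_ge {c : A} {s : ℕ → A} {w : List (A ⊕ A)}
    (h : IsSequenceCode c s w) : ∃ m, ∀ i ≥ m, s i = c := by
  refine ⟨w.length, fun i hi => ?_⟩
  rw [(h.2 i).2, List.getElem?_eq_none (by omega)]
  rfl

/-- The tail value is determined by `s`, and since a code cannot end in `Sum.inr c`, it stops
exactly where `s` becomes constant. -/
theorem IsSequenceCode.eq {c c' : A} {s : ℕ → A} {w w' : List (A ⊕ A)}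
    (h : IsSequenceCode c s w) (h' : IsSequenceCode c' s w') : w = w' := by
  obtain ⟨m, hm⟩ := h.exists_forall_ge
  obtain ⟨m', hm'⟩ := h'.exists_forall_ge
  obtain rfl : c = c' := by
    rw [← hm (max m m') (le_max_left _ _), hm' (max m m') (le_max_right _ _)]
  have key : ∀ {w}, IsSequenceCode c s w → ∀ i : ℕ, w[i + 1]? = none ↔ ∀ t ≥ i, s t = c := by
    intro w h i
    refine ⟨fun hi t ht => ?_, fun hc => ?_⟩
    · rw [List.getElem?_eq_none_iff] at hi
      rw [(h.2 t).2, List.getElem?_eq_none (by omega)]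
      rfl
    · by_contra hne
      have hlen : i + 1 < w.length := by
        rw [List.getElem?_eq_none_iff] at hne; omega
      obtain ⟨t, ht⟩ := Nat.exists_eq_add_of_lt hlen
      have hlast : w[i + t + 1]? = some (Sum.inr c) := by
        rcases hv : w[i + t + 1]? with _ | (a | a)
        · rw [List.getElem?_eq_none_iff] at hv; omega
        · exact ((h.2 (i + t)).1.1 a hv).elim
        · have h1 := (h.2 (i + t)).2
          rw [hv, hc (i + t) (by omega)] at h1
          rw [h1]; rfl
      exact (h.2 (i + t + 1)).1.2 hlast (List.getElem?_eq_none (by omega))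
  have key2 : ∀ {w}, IsSequenceCode c s w → ∀ i : ℕ, w[i + 1]? ≠ none →
      w[i + 1]? = some (Sum.inr (s i)) := by
    intro w h i hi
    rw [(h.2 i).2]
    rcases hv : w[i + 1]? with _ | (a | a)
    · exact (hi hv).elim
    · exact ((h.2 i).1.1 a hv).elim
    · rfl
  refine List.ext_getElem? fun i => ?_
  cases i with
  | zero => rw [h.1, h'.1]
  | succ i =>
    by_cases hi : ∀ t ≥ i, s t = c
    · rw [(key h i).2 hi, (key h' i).2 hi]
    · rw [key2 h i fun h0 => hi ((key h i).1 h0), key2 h' i fun h0 => hi ((key h' i).1 h0)]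

/-- The word coding an eventually constant sequence. -/
noncomputable def sequenceCode (s : ℕ → A) : List (A ⊕ A) :=
  Classical.epsilon fun w => ∃ c, IsSequenceCode c s w

theorem eq_sequenceCode_iff {s : ℕ → A} (hs : ∃ c m, ∀ i ≥ m, s i = c) {w : List (A ⊕ A)} :
    w = sequenceCode s ↔ ∃ c, IsSequenceCode c s w := by
  obtain ⟨c, hc⟩ := hs
  obtain ⟨v, hv⟩ := exists_isSequenceCode hc
  have hspec : ∃ c, IsSequenceCode c s (sequenceCode s) :=
    Classical.epsilon_spec (p := fun w => ∃ c, IsSequenceCode c s w) ⟨v, c, hv⟩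
  constructor
  · rintro rfl; exact hspec
  · rintro ⟨c', hc'⟩
    obtain ⟨c'', hc''⟩ := hspec
    exact hc'.eq hc''

theorem sequenceCode_injOn {s t : ℕ → A} (hs : ∃ c m, ∀ i ≥ m, s i = c)
    (ht : ∃ c m, ∀ i ≥ m, t i = c) (h : sequenceCode s = sequenceCode t) : s = t := by
  obtain ⟨c, hc⟩ := (eq_sequenceCode_iff hs).1 rfl
  obtain ⟨d, hd⟩ := (eq_sequenceCode_iff ht).1 rfl
  rw [h] at hc
  obtain rfl : c = d := by simpa using hc.1.symm.trans hd.1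
  funext i
  rw [(hc.2 i).2, (hd.2 i).2]

/-- Relations defined by pointwise conditions on eventually constant sequences are regular. -/
theorem isRegularRelation_sequenceCode [Finite A] {k : ℕ} (ρ : (Fin k → A) → Prop) :
    IsRegularRelation {x | ∃ s : Fin k → ℕ → A, (∀ j, ∃ c m, ∀ i ≥ m, s j i = c) ∧
      (∀ i, ρ fun j => s j i) ∧ x = fun j => sequenceCode (s j)} := by
  -- The parameter is the tuple of tail values, announced by the first letters; it makes `ρ`
  -- checkable even where some codes have already ended.
  refine isRegularRelation_of_local (ι := Fin k → A)
    (fun c u => ∀ j, u j = some (Sum.inl (c j)))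
    (fun c u v => (∀ j, IsCodeStep (c j) (u j) (v j)) ∧ ρ fun j => codeValue (c j) (v j))
    fun x => ⟨?_, ?_⟩
  · rintro ⟨s, hs, hρ, rfl⟩
    choose c hc using fun j => (eq_sequenceCode_iff (hs j)).1 rfl
    refine ⟨c, fun j => (hc j).1, fun i => ⟨fun j => ((hc j).2 i).1, ?_⟩⟩
    simpa only [← ((hc _).2 i).2] using hρ i
  · rintro ⟨c, h0, hc⟩
    have hcode : ∀ j, IsSequenceCode (c j) (fun i => codeValue (c j) (x j)[i + 1]?) (x j) :=
      fun j => ⟨h0 j, fun i => ⟨(hc i).1 j, rfl⟩⟩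
    have hs : ∀ j, ∃ c' m, ∀ i ≥ m, codeValue (c j) (x j)[i + 1]? = c' :=
      fun j => ⟨c j, (hcode j).exists_forall_ge⟩
    exact ⟨fun j i => codeValue (c j) (x j)[i + 1]?, hs, fun i => (hc i).2,
      funext fun j => (eq_sequenceCode_iff (hs j)).2 ⟨c j, hcode j⟩⟩

theorem isRegular_range_sequenceCode [Finite A] :
    _root_.Language.IsRegular (T := A ⊕ A)
      {w | ∃ s : ℕ → A, (∃ c m, ∀ i ≥ m, s i = c) ∧ w = sequenceCode s} := by
  refine (congrArg _root_.Language.IsRegular (Set.ext fun w => ⟨?_, ?_⟩)).mp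
    (Language.isRegular_of_local (fun (c : A) (u : Option (A ⊕ A)) => u = some (Sum.inl c))
      IsCodeStep)
  · rintro ⟨c, h0, hc⟩
    have hcode : IsSequenceCode c (fun i => codeValue c w[i + 1]?) w :=
      ⟨h0, fun i => ⟨hc i, rfl⟩⟩
    have hs := hcode.exists_forall_ge
    exact ⟨_, ⟨c, hs⟩, (eq_sequenceCode_iff ⟨c, hs⟩).2 ⟨c, hcode⟩⟩
  · rintro ⟨s, hs, hw⟩
    obtain ⟨c, hc⟩ := (eq_sequenceCode_iff hs).1 hw
    exact ⟨c, hc.1, fun i => (hc.2 i).1⟩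

end

/-- A Boolean algebra of all eventually constant sequences in a finite Boolean algebra is word
automata presentable. -/
theorem IsWordAutomataPresentable.of_eventually_constant {B : Type*} [BooleanAlgebra B] {A : Type}
    [BooleanAlgebra A] [Finite A] (val : B → ℕ → A) (hinj : Function.Injective val)
    (hrange : ∀ s, s ∈ Set.range val ↔ ∃ c m, ∀ i ≥ m, s i = c)
    (hval : ∀ (k : ℕ) (f : booleanLanguage.Functions k) (a : Fin k → B) (i : ℕ),
      val (FirstOrder.Language.Structure.funMap f a) i =
        FirstOrder.Language.Structure.funMap f fun j => val (a j) i) :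
    IsWordAutomataPresentable booleanLanguage B := by
  have hconst : ∀ b, ∃ c m, ∀ i ≥ m, val b i = c := fun b => (hrange _).1 ⟨b, rfl⟩
  refine .of_encoding (fun b => sequenceCode (val b))
    (fun a b h => hinj (sequenceCode_injOn (hconst a) (hconst b) h)) ?_ fun k f => ?_
  · refine (congrArg _root_.Language.IsRegular (Set.ext fun w => ⟨?_, ?_⟩)).mp
      (isRegular_range_sequenceCode (A := A))
    · rintro ⟨s, hs, rfl⟩
      obtain ⟨b, rfl⟩ := (hrange s).2 hs
      exact ⟨b, rfl⟩
    · rintro ⟨b, rfl⟩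
      exact ⟨val b, hconst b, rfl⟩
  · refine (congrArg IsRegularRelation (Set.ext fun x => ⟨?_, ?_⟩)).mp
      (isRegularRelation_sequenceCode (A := A) (k := k + 1) fun u => u (Fin.last k) =
        FirstOrder.Language.Structure.funMap f fun j : Fin k => u j.castSucc)
    · rintro ⟨s, hs, hρ, rfl⟩
      choose b hb using fun j => (hrange (s j)).2 (hs j)
      obtain rfl : (fun j => val (b j)) = s := funext hb
      refine ⟨fun j => b j.castSucc, ?_⟩
      have : b (Fin.last k) = FirstOrder.Language.Structure.funMap f fun j : Fin k =>
          b j.castSucc := hinj (funext fun i => (hρ i).trans (hval k f _ i).symm)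
      rw [← this]
      funext j
      induction j using Fin.lastCases <;> simp
    · rintro ⟨a, rfl⟩
      refine ⟨fun j => val ((Fin.snoc a (FirstOrder.Language.Structure.funMap f a) :
        Fin (k + 1) → B) j), fun j => hconst _, fun i => ?_, ?_⟩
      · simpa using hval k f a i
      · funext j
        induction j using Fin.lastCases <;> simp

/-- Transposing turns an `n`-tuple of subsets of `ℕ` into a sequence in `Set (Fin n)`; it is
eventually constant exactly when every set is finite or cofinite, the tail value being the set of
cofinite coordinates. -/
theorem isWordAutomataPresentable_finiteCofinite_pow (n : ℕ) :
    IsWordAutomataPresentable booleanLanguage (Fin n → finiteCofinite) := by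
  refine .of_eventually_constant (A := Set (Fin n))
    (fun b i => {j | i ∈ (b j : Set ℕ)}) ?_ (fun s => ⟨?_, ?_⟩) ?_
  · intro a b h
    funext j
    refine Subtype.ext (Set.ext fun i => ?_)
    exact Set.ext_iff.1 (congrFun h i) j
  · rintro ⟨b, rfl⟩
    have hev : ∀ j, ∃ m, ∀ i ≥ m, (i ∈ (b j : Set ℕ) ↔ (b j : Set ℕ)ᶜ.Finite) := by
      intro j
      by_cases hfin : (b j : Set ℕ)ᶜ.Finite
      · obtain ⟨m, hm⟩ := hfin.bddAbove
        refine ⟨m + 1, fun i hi => iff_of_true ?_ hfin⟩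
        by_contra hcon
        exact absurd (hm hcon) (by omega)
      · obtain ⟨m, hm⟩ := ((b j).2.resolve_right hfin).bddAbove
        exact ⟨m + 1, fun i hi => iff_of_false (fun hcon => absurd (hm hcon) (by omega)) hfin⟩
    choose m hm using hev
    refine ⟨{j | (b j : Set ℕ)ᶜ.Finite}, Finset.univ.sup m, fun i hi => Set.ext fun j => ?_⟩
    exact hm j i ((Finset.le_sup (Finset.mem_univ j)).trans hi)
  · rintro ⟨c, m, hm⟩
    refine ⟨fun j => ⟨{i | j ∈ s i}, ?_⟩, rfl⟩
    by_cases hj : j ∈ c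
    · refine Or.inr ((Set.finite_lt_nat m).subset fun i hi => ?_)
      by_contra hcon
      exact hi (show j ∈ s i by rwa [hm i (not_lt.1 hcon)])
    · refine Or.inl ((Set.finite_lt_nat m).subset fun i hi => ?_)
      by_contra hcon
      exact hj (by rw [← hm i (not_lt.1 hcon)]; exact hi)
  · intro k f a i
    change BooleanFunctions k at f
    cases f <;> rfl

theorem mainTheorem2 (B : Type*) [BooleanAlgebra B] :
    IsWordAutomataPresentable booleanLanguage B ↔
      Finite B ∨ ∃ n : ℕ, 1 ≤ n ∧ Nonempty (booleanLanguage.Equiv B (Fin n → finiteCofinite)) := by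
  refine ⟨fun h => h.finite_or_nonempty_equiv, ?_⟩
  rintro (hB | ⟨n, -, ⟨e⟩⟩)
  · exact .of_finite B
  · exact .of_equiv e (isWordAutomataPresentable_finiteCofinite_pow n)
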